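/- Let $G$ be a finite simple graph (not necessarily connected) of order $n \equiv 4 \pmod 8$ such that every connected component of $G$ has at least $3$ vertices and such that, in every component of $G$ that is bipartite, both color classes have even order. For a finite Abelian group $\mathcal{G}$ (written additively), an edge labeling $f : E(G) \to \mathcal{G}$ is called $\mathcal{G}$-irregular if the weighted degrees $w(v) = \sum_{u \in N(v)} f(uv)$, $v \in V(G)$, are pairwise distinct. Let the group irregularity strength $s_g(G)$ be the smallest positive integer $s$ such that for every Abelian group $\mathcal{G}$ of order $s$ there exists a $\mathcal{G}$-irregular edge labeling of $G$. Then $s_g(G)$ exists and $s_g(G) = n$. -/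

import Mathlib

namespace GroupIrregularity

open Classical in
/-- The weighted degree of `v`: the sum of the labels of all the edges of `G` incident to `v`. -/
noncomputable def weightedDegree {V : Type*} [Fintype V] (G : SimpleGraph V)
    {A : Type*} [AddCommGroup A] (f : G.edgeSet → A) (v : V) : A :=
  ∑ e : G.edgeSet with v ∈ e.1, f e

/-- An edge labeling with values in an Abelian group is irregular if the weighted degrees of all
the vertices are distinct. -/
def IsIrregular {V : Type*} [Fintype V] (G : SimpleGraph V)
    {A : Type*} [AddCommGroup A] (f : G.edgeSet → A) : Prop :=
  Function.Injective (weightedDegree G f)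

/-- The positive integer `s` is such that every Abelian group of order `s` admits an irregular
edge labeling of `G`. (Every finite group is isomorphic to one living in `Type`; positivity
is needed because `Nat.card` is `0` on infinite groups.) -/
def AdmitsAllOfOrder {V : Type*} [Fintype V] (G : SimpleGraph V) (s : ℕ) : Prop :=
  0 < s ∧ ∀ (A : Type) [AddCommGroup A], Nat.card A = s → ∃ f : G.edgeSet → A, IsIrregular G f

/-- `s` is the group irregularity strength of `G`: the smallest positive integer such that every
Abelian group of order `s` admits an irregular edge labeling of `G`. -/
def IsGroupIrregularityStrength {V : Type*} [Fintype V] (G : SimpleGraph V) (s : ℕ) : Prop :=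
  IsLeast {t : ℕ | AdmitsAllOfOrder G t} s

/-- Every bipartite component of `G` has both color classes of even order. (A component is
bipartite iff it has a proper coloring by `Bool`, which is then unique up to swapping colors.) -/
def BipartiteComponentsEven {V : Type*} (G : SimpleGraph V) : Prop :=
  ∀ (c : G.ConnectedComponent) (C : c.toSimpleGraph.Coloring Bool) (b : Bool),
    Even (C.colorClass b).ncard

end GroupIrregularity

/-! A labeling in `ZMod t` with distinct weighted degrees injects the vertices into a set of size
`t`, so `t ≥ n`. For the converse let `A` have order `n = 4m`, `m` odd. Alternating signs along a
walk transports a value between vertices. Hence `w : V → A` is a weighted degree as soon as its sum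
over each non-bipartite component lies in `2A` and its sums over the two color classes of each
bipartite component agree (`exists_weightedDegree_eq`). It remains to partition `A` into sets of the
sizes of these classes with suitable sums. Split `A = T ⊕ H` with `|T| = 4`, `|H| = m`
(`exists_decomposition`). Outside `T` every element differs from its negative, so once a symmetric
family of small cores covering `T` is placed with the right parities, zero-sum pairs `{x, -x}` fill
the rest (`exists_extension`). If all sizes are even, the cores are two pairs partitioning `T` with
equal sums (`exists_allocation_even`). Otherwise each odd class, necessarily a non-bipartite
component, receives a triple with sum in `2A` (`exists_allocation_odd`). -/

namespace GroupIrregularity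

open Finset

/-! ### Filling classes with pairs `{x, -x}`. -/

/-- Disjoint subsets of prescribed sizes can be carved out of `B` one after another. -/
theorem exists_disjoint_family {A K : Type*} [DecidableEq A] {P R : Finset A → Prop}
    {good : ℕ → Prop}
    (h : ∀ B j, P B → good j → j ≤ #B → ∃ Q ⊆ B, #Q = j ∧ R Q ∧ P (B \ Q))
    (s : K → ℕ) (C : Finset K) (B : Finset A) (hB : P B) (hs : ∀ c ∈ C, good (s c))
    (hsum : ∑ c ∈ C, s c ≤ #B) :
    ∃ Q : K → Finset A, (∀ c ∈ C, Q c ⊆ B ∧ #(Q c) = s c ∧ R (Q c)) ∧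
      (C : Set K).PairwiseDisjoint Q := by
  classical
  induction C using Finset.induction_on generalizing B with
  | empty => exact ⟨fun _ => ∅, by simp, by simp⟩
  | insert k C hk ih =>
    rw [sum_insert hk] at hsum
    obtain ⟨Q₀, hQ₀, hcard, hR, hP⟩ := h B (s k) hB (hs k (mem_insert_self _ _)) (by omega)
    obtain ⟨Q, hQ, hdis⟩ := ih (B \ Q₀) hP (fun c hc => hs c (mem_insert_of_mem hc))
      (by rw [card_sdiff_of_subset hQ₀]; omega)
    have hne : ∀ c ∈ C, c ≠ k := fun c hc h => hk (h ▸ hc)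
    refine ⟨Function.update Q k Q₀, ?_, ?_⟩
    · intro c hc
      rcases mem_insert.1 hc with rfl | hc
      · simpa using ⟨hQ₀, hcard, hR⟩
      · rw [Function.update_of_ne (hne c hc)]
        exact ⟨(hQ c hc).1.trans sdiff_subset, (hQ c hc).2⟩
    · rw [coe_insert, Set.pairwiseDisjoint_insert_of_notMem (by simpa using hk)]
      refine ⟨fun c hc d hd hcd => ?_, fun c hc => ?_⟩
      · have := hdis hc hd hcd
        simpa [Function.onFun, Function.update_of_ne (hne c hc),
          Function.update_of_ne (hne d hd)] using this
      · rw [Function.update_self, Function.update_of_ne (hne c hc)]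
        exact (disjoint_sdiff.mono_right (hQ c hc).1)

/-- A finite set that splits into pairs `{x, -x}` with `x ≠ -x`. -/
def IsNegPaired {A : Type*} [AddCommGroup A] (B : Finset A) : Prop :=
  ∀ x ∈ B, -x ∈ B ∧ -x ≠ x

namespace IsNegPaired

variable {A : Type*} [AddCommGroup A] {B Q : Finset A}

theorem sdiff [DecidableEq A] (hB : IsNegPaired B) (hQ : IsNegPaired Q) : IsNegPaired (B \ Q) := by
  intro x hx
  rw [mem_sdiff] at hx ⊢
  exact ⟨⟨(hB x hx.1).1, fun h => hx.2 (by simpa using (hQ _ h).1)⟩, (hB x hx.1).2⟩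

theorem sum_eq_zero (hB : IsNegPaired B) : ∑ x ∈ B, x = 0 :=
  Finset.sum_involution (fun x _ => -x) (fun x _ => add_neg_cancel x)
    (fun x hx _ => (hB x hx).2) (fun x hx => (hB x hx).1) (fun x _ => neg_neg x)

theorem exists_subset [DecidableEq A] (hB : IsNegPaired B) (i : ℕ) (hi : i + i ≤ #B) :
    ∃ Q ⊆ B, #Q = i + i ∧ IsNegPaired Q := by
  induction i with
  | zero => exact ⟨∅, by simp, by simp, by simp [IsNegPaired]⟩
  | succ i ih =>
    obtain ⟨Q, hQB, hcard, hQ⟩ := ih (by omega)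
    obtain ⟨x, hx⟩ : (B \ Q).Nonempty := by
      rw [← card_pos, card_sdiff_of_subset hQB]; omega
    have hx' := hB.sdiff hQ x hx
    rw [mem_sdiff] at hx
    rw [mem_sdiff] at hx'
    refine ⟨insert x (insert (-x) Q), ?_, ?_, ?_⟩
    · simp [insert_subset_iff, hx.1, hx'.1.1, hQB]
    · rw [card_insert_of_notMem, card_insert_of_notMem hx'.1.2, hcard]
      · omega
      · simp [hx.2, hx'.2.symm]
    · intro y hy
      simp only [mem_insert] at hy ⊢
      rcases hy with rfl | rfl | hy
      · exact ⟨by simp, hx'.2⟩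
      · exact ⟨by simp, by simpa using hx'.2.symm⟩
      · exact ⟨.inr (.inr (hQ y hy).1), (hQ y hy).2⟩

end IsNegPaired

/-- Disjoint sets whose union has a complement that splits into pairs `{x, -x}` extend to disjoint
sets of prescribed sizes with the same sums, if the differences of the sizes are even. -/
theorem exists_extension {A K : Type*} [AddCommGroup A] [Fintype A] [Fintype K] (s : K → ℕ)
    (hs : ∑ c, s c = Fintype.card A) (R : K → Finset A) (hR : Pairwise fun c d => Disjoint (R c) (R d))
    (hle : ∀ c, #(R c) ≤ s c) (heven : ∀ c, Even (s c - #(R c)))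
    (hneg : ∀ c, ∀ x ∈ R c, ∃ d, -x ∈ R d) (htwo : ∀ x : A, -x = x → ∃ d, x ∈ R d) :
    ∃ Q : K → Finset A, (∀ c, #(Q c) = s c) ∧ (Pairwise fun c d => Disjoint (Q c) (Q d)) ∧
      ∀ c, ∑ x ∈ Q c, x = ∑ x ∈ R c, x := by
  classical
  set U : Finset A := univ.biUnion R with hU
  have hUcard : #U = ∑ c, #(R c) := card_biUnion fun c _ d _ h => hR h
  -- The union of the cores is symmetric and contains every solution of `-x = x`, so its complement
  -- consists of genuine pairs.
  have hB : IsNegPaired Uᶜ := by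
    intro x hx
    simp only [hU, mem_compl, mem_biUnion, mem_univ, true_and, not_exists] at hx ⊢
    refine ⟨fun c hc => ?_, fun h => ?_⟩
    · obtain ⟨d, hd⟩ := hneg c _ hc
      exact hx d (by simpa using hd)
    · obtain ⟨d, hd⟩ := htwo x h
      exact hx d hd
  obtain ⟨Q, hQ, hdis⟩ := exists_disjoint_family (P := IsNegPaired) (R := IsNegPaired)
    (good := Even) (fun B j hB ⟨i, hi⟩ hj => by
      obtain ⟨Q, h1, h2, h3⟩ := hB.exists_subset i (by omega)
      exact ⟨Q, h1, by omega, h3, hB.sdiff h3⟩)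
    (fun c => s c - #(R c)) univ Uᶜ hB (fun c _ => heven c) (by
      have h1 : ∑ c, (s c - #(R c)) + ∑ c, #(R c) = ∑ c, s c := by
        rw [← sum_add_distrib]
        exact sum_congr rfl fun c _ => Nat.sub_add_cancel (hle c)
      rw [card_compl]; omega)
  have hRQ : ∀ c d, Disjoint (R c) (Q d) := fun c d => by
    have h1 : R c ⊆ U := subset_biUnion_of_mem R (mem_univ c)
    exact (disjoint_compl_right (a := U)).mono h1 (hQ d (mem_univ d)).1
  refine ⟨fun c => R c ∪ Q c, fun c => ?_, fun c d hcd => ?_, fun c => ?_⟩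
  · rw [card_union_of_disjoint (hRQ c c), (hQ c (mem_univ c)).2.1]
    have := hle c; omega
  · simp only [disjoint_union_left, disjoint_union_right]
    exact ⟨⟨hR hcd, (hRQ _ _).symm⟩, hRQ _ _, hdis (mem_univ c) (mem_univ d) hcd⟩
  · rw [sum_union (hRQ c c), (hQ c (mem_univ c)).2.2.sum_eq_zero, add_zero]

/-! ### Structure of groups of order `4m`. -/

/-- An Abelian group of order `4 * m`, `m` odd, is the direct sum of a subgroup
`T = {0, b, c, b + c}` and a subgroup `H` of order `m`. -/
theorem exists_decomposition {A : Type*} [AddCommGroup A] [Fintype A] {m : ℕ} (hm : Odd m)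
    (hA : Fintype.card A = 4 * m) :
    ∃ (T H : AddSubgroup A) (b c : A), Nat.card H = m ∧ b ≠ 0 ∧ c ≠ 0 ∧ b ≠ c ∧ b + c ≠ 0 ∧
      (∀ x, x ∈ T ↔ x = 0 ∨ x = b ∨ x = c ∨ x = b + c) ∧ (∀ x, -x = x → x ∈ T) ∧
      (∀ x ∈ H, Even x) ∧ ∀ x ∈ T, x ∈ H → x = 0 := by
  classical
  -- `T` is the kernel and `H` the range of multiplication by 4; Cauchy's theorem and coprimality
  -- determine both orders from their product `4m`.
  let φ : A →+ A := nsmulAddMonoidHom 4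
  have hφ : ∀ x, φ x = 4 • x := fun x => rfl
  have hTH : Nat.card φ.ker * Nat.card φ.range = 4 * m := by
    rw [← hA, ← Nat.card_eq_fintype_card, AddSubgroup.card_eq_card_quotient_mul_card_addSubgroup φ.ker,
      Nat.card_congr (QuotientAddGroup.quotientKerEquivRange φ).toEquiv, mul_comm]
  have hinter : ∀ j : ℕ, Nat.Coprime j m → ∀ x ∈ φ.range, j • x = 0 → x = 0 := by
    rintro j hj x ⟨y, rfl⟩ h
    have h2 : m • φ y = 0 := by
      rw [hφ, ← mul_nsmul, ← hA]; exact card_nsmul_eq_zero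
    have := Nat.dvd_gcd (addOrderOf_dvd_of_nsmul_eq_zero h) (addOrderOf_dvd_of_nsmul_eq_zero h2)
    rw [Nat.coprime_iff_gcd_eq_one.1 hj, Nat.dvd_one] at this
    exact AddMonoid.addOrderOf_eq_one_iff.1 this
  have hcop2 : Nat.Coprime 2 m := Nat.coprime_two_left.2 hm
  have hcop4 : Nat.Coprime 4 m := Nat.Coprime.pow_left 2 hcop2
  have hHodd : ¬ 2 ∣ Nat.card φ.range := by
    intro h
    obtain ⟨x, hx⟩ := exists_prime_addOrderOf_dvd_card' 2 h
    have h0 := hinter 2 hcop2 x x.2 (by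
      rw [← AddSubgroup.coe_nsmul, ← hx, addOrderOf_nsmul_eq_zero]; rfl)
    have : x = 0 := Subtype.ext h0
    rw [this, addOrderOf_zero] at hx
    omega
  have hTcop : Nat.Coprime (Nat.card φ.ker) m := by
    refine Nat.coprime_of_dvd fun p hp h1 h2 => ?_
    have := Fact.mk hp
    obtain ⟨x, hx⟩ := exists_prime_addOrderOf_dvd_card' p h1
    have h4 : 4 • x = 0 := Subtype.ext x.2
    have h5 := Nat.dvd_gcd (hx ▸ addOrderOf_dvd_of_nsmul_eq_zero h4) h2
    rw [Nat.coprime_iff_gcd_eq_one.1 hcop4, Nat.dvd_one] at h5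
    exact hp.one_lt.ne' h5
  have hT4 : Nat.card φ.ker ∣ 4 := hTcop.dvd_of_dvd_mul_right (Dvd.intro _ hTH)
  have hHm : Nat.card φ.range ∣ m := by
    have : Nat.Coprime (Nat.card φ.range) 4 :=
      (Nat.Coprime.pow_left 2 ((Nat.Prime.coprime_iff_not_dvd Nat.prime_two).2 hHodd)).symm
    exact this.dvd_of_dvd_mul_left (Dvd.intro_left _ hTH)
  have hm0 : 0 < m := hm.pos
  have h1 := Nat.le_of_dvd (by norm_num) hT4
  have h2 := Nat.le_of_dvd hm0 hHm
  have hTcard : Nat.card φ.ker = 4 := by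
    by_contra h
    have : Nat.card φ.ker * Nat.card φ.range ≤ 3 * m := Nat.mul_le_mul (by omega) h2
    omega
  have hHcard : Nat.card φ.range = m := by
    rw [hTcard] at hTH; omega
  let TF : Finset A := univ.filter (· ∈ φ.ker)
  have hTF : ∀ x, x ∈ TF ↔ x ∈ φ.ker := by simp [TF]
  have hTFcard : #TF = 4 := by
    rw [← hTcard, Nat.card_eq_fintype_card, Fintype.card_subtype]
  obtain ⟨b, hb, hb0⟩ := exists_mem_notMem_of_card_lt_card (s := {0}) (t := TF) (by simp [hTFcard])
  -- Excluding `-b` makes `b + c` the fourth element of `T`, whether `T` is cyclic or a Klein group.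
  obtain ⟨c, hc, hc0⟩ := exists_mem_notMem_of_card_lt_card (s := {0, b, -b}) (t := TF)
    (by rw [hTFcard]; exact card_le_three.trans_lt (by norm_num))
  simp only [mem_singleton] at hb0
  simp only [mem_insert, mem_singleton, not_or] at hc0
  obtain ⟨hc0, hcb, hcb'⟩ := hc0
  have hbc : b + c ≠ 0 := fun h => hcb' (neg_eq_of_add_eq_zero_right h).symm
  have hsub : ({0, b, c, b + c} : Finset A) ⊆ TF := by
    simp only [insert_subset_iff, singleton_subset_iff]
    refine ⟨(hTF 0).2 (zero_mem _), hb, hc, (hTF _).2 (add_mem ((hTF _).1 hb) ((hTF _).1 hc))⟩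
  have heq : ({0, b, c, b + c} : Finset A) = TF := by
    refine eq_of_subset_of_card_le hsub ?_
    rw [hTFcard, card_insert_of_notMem, card_insert_of_notMem, card_insert_of_notMem,
      card_singleton]
    · simp [hb0]
    · simp [hc0, Ne.symm hcb]
    · simp [Ne.symm hb0, Ne.symm hc0, hbc.symm]
  refine ⟨φ.ker, φ.range, b, c, hHcard, hb0, hc0, Ne.symm hcb, hbc, fun x => ?_, fun x hx => ?_,
    ?_, fun x hx hx' => hinter 4 hcop4 x hx' hx⟩
  · rw [← hTF, ← heq]; simp
  · rw [AddMonoidHom.mem_ker, hφ]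
    have : x + x = 0 := by nth_rw 1 [← hx]; simp
    rw [show 4 = 2 * 2 from rfl, mul_nsmul, two_nsmul x, this, nsmul_zero]
  · rintro _ ⟨y, rfl⟩
    exact ⟨2 • y, by rw [hφ, ← add_nsmul]⟩

/-! ### Allocation when all sizes are even. -/

/-- The allocation of the group elements if all sizes are even. -/
theorem exists_allocation_even {A K : Type*} [AddCommGroup A] [Fintype A] [Fintype K]
    [DecidableEq K] {m : ℕ} (hm : Odd m) (hA : Fintype.card A = 4 * m) (s : K → ℕ)
    (hs : ∑ c, s c = Fintype.card A) (heven : ∀ c, Even (s c)) (k l : K)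
    (hk : 2 ≤ s k) (hl : 2 ≤ s l) (hkl : k = l → 4 ≤ s k) :
    ∃ (a : A) (Q : K → Finset A), (∀ c, #(Q c) = s c) ∧
      (Pairwise fun c d => Disjoint (Q c) (Q d)) ∧
      ∀ c, ∑ x ∈ Q c, x = (if c = k then a else 0) + if c = l then a else 0 := by
  classical
  obtain ⟨T, H, b, c, -, hb, hc, hbc, hbc0, hT, htwo, -, -⟩ := exists_decomposition hm hA
  -- `X` and `Y` partition `T` and both sum to `b + c`. They serve the two color classes of one
  -- bipartite component, or together give the even sum `2(b + c)` when `k = l`.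
  let X : Finset A := {0, b + c}
  let Y : Finset A := {b, c}
  have hXc : #X = 2 := card_pair hbc0.symm
  have hYc : #Y = 2 := card_pair hbc
  have hXY : Disjoint X Y := by
    simp [X, Y, hb, hc]
  have hXs : ∑ x ∈ X, x = b + c := by simp [X, sum_pair hbc0.symm]
  have hYs : ∑ x ∈ Y, x = b + c := sum_pair hbc
  let R₁ : K → Finset A := fun i => if i = k then X else ∅
  let R₂ : K → Finset A := fun i => if i = l then Y else ∅
  have hR₁ : ∀ i, R₁ i ⊆ X := fun i => by dsimp only [R₁]; split_ifs <;> simp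
  have hR₂ : ∀ i, R₂ i ⊆ Y := fun i => by dsimp only [R₂]; split_ifs <;> simp
  have hdis : ∀ i j, Disjoint (R₁ i) (R₂ j) := fun i j => hXY.mono (hR₁ i) (hR₂ j)
  have hmem : ∀ x ∈ T, ∃ i, x ∈ R₁ i ∪ R₂ i := by
    intro x hx
    rcases (hT x).1 hx with h | h | h | h
    · exact ⟨k, by simp [R₁, X, h]⟩
    · exact ⟨l, by simp [R₂, Y, h]⟩
    · exact ⟨l, by simp [R₂, Y, h]⟩
    · exact ⟨k, by simp [R₁, X, h]⟩
  have hmem' : ∀ i, ∀ x ∈ R₁ i ∪ R₂ i, x ∈ T := by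
    intro i x hx
    rw [hT]
    rcases mem_union.1 hx with h | h
    · have := hR₁ i h
      simp only [X, mem_insert, mem_singleton] at this
      tauto
    · have := hR₂ i h
      simp only [Y, mem_insert, mem_singleton] at this
      tauto
  let R : K → Finset A := fun i => R₁ i ∪ R₂ i
  have hcard : ∀ i, #(R i) = (if i = k then 2 else 0) + if i = l then 2 else 0 := by
    intro i
    dsimp only [R]
    rw [card_union_of_disjoint (hdis i i)]
    congr 1
    · dsimp only [R₁]; split_ifs <;> simp [hXc]
    · dsimp only [R₂]; split_ifs <;> simp [hYc]
  have hRdisj : Pairwise fun c d => Disjoint (R c) (R d) := by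
    intro i j hij
    simp only [R, disjoint_union_left, disjoint_union_right]
    refine ⟨⟨?_, (hdis _ _).symm⟩, hdis _ _, ?_⟩
    · dsimp only [R₁]
      split_ifs with h h'
      · exact absurd (h.trans h'.symm) hij
      all_goals simp
    · dsimp only [R₂]
      split_ifs with h h'
      · exact absurd (h.trans h'.symm) hij
      all_goals simp
  have hRle : ∀ c, #(R c) ≤ s c := by
    intro i
    rw [hcard]
    split_ifs with h h' h'
    · subst h; exact hkl h'
    · subst h; simpa using hk
    · subst h'; simpa using hl
    · simp
  have hReven : ∀ c, Even (s c - #(R c)) := by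
    intro i
    rw [hcard]
    refine (heven i).tsub ?_
    split_ifs <;> decide
  obtain ⟨Q, h1, h2, h3⟩ := exists_extension s hs R hRdisj hRle hReven
    (fun i x hx => hmem _ (neg_mem (hmem' i x hx))) (fun x hx => hmem x (htwo x hx))
  refine ⟨b + c, Q, h1, h2, fun i => ?_⟩
  rw [h3, sum_union (hdis i i)]
  congr 1
  · dsimp only [R₁]; split_ifs <;> simp [hXs]
  · dsimp only [R₂]; split_ifs <;> simp [hYs]

/-! ### Allocation when some size is odd. -/

/-- A subgroup without involutions contains a symmetric set of any odd size with `0`. -/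
theorem exists_symmetric_subset {A : Type*} [AddCommGroup A] [Fintype A] (H : AddSubgroup A)
    (htwo : ∀ x ∈ H, -x = x → x = 0) {j : ℕ} (hj : Odd j) (hjH : j ≤ Nat.card H) :
    ∃ S : Finset A, #S = j ∧ 0 ∈ S ∧ (∀ x ∈ S, x ∈ H) ∧ ∀ x ∈ S, -x ∈ S := by
  classical
  obtain ⟨i, rfl⟩ := hj
  let B : Finset A := (univ.filter (· ∈ H)).erase 0
  have hB : IsNegPaired B := by
    intro x hx
    simp only [B, mem_erase, mem_filter, mem_univ, true_and] at hx ⊢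
    exact ⟨⟨neg_ne_zero.2 hx.1, neg_mem hx.2⟩, fun h => hx.1 (htwo x hx.2 h)⟩
  have hBc : #B = Nat.card H - 1 := by
    rw [card_erase_of_mem (by simp), Nat.card_eq_fintype_card, Fintype.card_subtype]
  obtain ⟨Q, hQB, hQc, hQ⟩ := hB.exists_subset i (by omega)
  have hQ0 : (0 : A) ∉ Q := fun h => by simpa [B] using hQB h
  refine ⟨insert 0 Q, by rw [card_insert_of_notMem hQ0, hQc]; omega, mem_insert_self _ _, ?_, ?_⟩
  · intro x hx
    rcases mem_insert.1 hx with rfl | hx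
    · exact zero_mem _
    · have := hQB hx
      simp only [B, mem_erase, mem_filter] at this
      exact this.2.2
  · intro x hx
    rcases mem_insert.1 hx with rfl | hx
    · simp
    · exact mem_insert_of_mem (hQ x hx).1

/-- An Abelian group of order `4 * m`, `m` odd, has a subgroup `T` of order `4` with a complement
`H` of order `m` such that the sums of the triples `(T \ {0}) + h` are even. -/
theorem exists_triples {A : Type*} [AddCommGroup A] [Fintype A] {m : ℕ} (hm : Odd m)
    (hA : Fintype.card A = 4 * m) :
    ∃ (T H : AddSubgroup A) (I : A → Finset A), Nat.card H = m ∧ (∀ x, -x = x → x ∈ T) ∧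
      (∀ x ∈ H, Even x) ∧ (∀ h x, x ∈ I h ↔ ∃ t ∈ T, t ≠ 0 ∧ x = t + h) ∧ (∀ h, #(I h) = 3) ∧
      (∀ h ∈ H, Even (∑ x ∈ I h, x)) ∧
      ∀ t ∈ T, ∀ t' ∈ T, ∀ h ∈ H, ∀ h' ∈ H, t + h = t' + h' → t = t' ∧ h = h' := by
  classical
  obtain ⟨T, H, b, c, hHc, hb, hc, hbc, hbc0, hT, htwo, hHeven, hTH⟩ := exists_decomposition hm hA
  let I : A → Finset A := fun h => {b + h, c + h, b + c + h}
  have hbbc : b ≠ b + c := by simpa using hc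
  have hcbc : c ≠ b + c := by simpa using hb
  have hI : ∀ h x, x ∈ I h ↔ ∃ t ∈ T, t ≠ 0 ∧ x = t + h := by
    intro h x
    simp only [I, mem_insert, mem_singleton, hT]
    constructor
    · rintro (rfl | rfl | rfl)
      · exact ⟨b, by simp, hb, rfl⟩
      · exact ⟨c, by simp, hc, rfl⟩
      · exact ⟨b + c, by simp, hbc0, rfl⟩
    · rintro ⟨t, h | h | h | h, ht, rfl⟩
      · exact absurd h ht
      all_goals simp [h]
  have hIc : ∀ h, #(I h) = 3 := fun h =>
    card_eq_three.2 ⟨_, _, _, by simpa using hbc, by simpa using hbbc, by simpa using hcbc, rfl⟩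
  have hIs : ∀ h ∈ H, Even (∑ x ∈ I h, x) := by
    intro h hh
    -- The nonzero elements of `T` sum to `2(b + c)`, and `h` itself is even.
    have : ∑ x ∈ I h, x = ((b + c) + (b + c)) + ((h + h) + h) := by
      dsimp only [I]
      rw [sum_insert, sum_pair]
      · abel
      · simpa using hcbc
      · simp only [mem_insert, mem_singleton, add_left_inj, not_or]
        exact ⟨hbc, hbbc⟩
    rw [this]
    exact (Even.add_self _).add ((Even.add_self _).add (hHeven h hh))
  have hdecomp : ∀ t ∈ T, ∀ t' ∈ T, ∀ h ∈ H, ∀ h' ∈ H, t + h = t' + h' → t = t' ∧ h = h' := by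
    intro t ht t' ht' h hh h' hh' heq
    have h1 : t - t' = h' - h := by
      rw [sub_eq_sub_iff_add_eq_add, heq, add_comm]
    have h2 := hTH _ (sub_mem ht ht') (h1 ▸ sub_mem hh' hh)
    exact ⟨sub_eq_zero.1 h2, (sub_eq_zero.1 (h1 ▸ h2)).symm⟩
  exact ⟨T, H, I, hHc, htwo, hHeven, hI, hIc, hIs, hdecomp⟩

/-- The allocation of the group elements if some size is odd. -/
theorem exists_allocation_odd {A K : Type*} [AddCommGroup A] [Fintype A] [Fintype K]
    {m : ℕ} (hm : Odd m) (hA : Fintype.card A = 4 * m) (s : K → ℕ)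
    (hs : ∑ c, s c = Fintype.card A) (hodd : ∃ c, Odd (s c)) (hthree : ∀ c, Odd (s c) → 3 ≤ s c) :
    ∃ Q : K → Finset A, (∀ c, #(Q c) = s c) ∧ (Pairwise fun c d => Disjoint (Q c) (Q d)) ∧
      (∀ c, Even (s c) → ∑ x ∈ Q c, x = 0) ∧ ∀ c, Even (∑ x ∈ Q c, x) := by
  classical
  obtain ⟨T, H, I, hHc, htwo, hHeven, hI, hIc, hIs, hdecomp⟩ := exists_triples hm hA
  have hH2 : ∀ x ∈ H, -x = x → x = 0 := fun x hx h =>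
    (hdecomp x (htwo x h) 0 (zero_mem _) 0 (zero_mem _) x hx (by simp)).1
  let O : Finset K := univ.filter fun c => Odd (s c)
  have hOeven : Even #O := by
    rw [← Nat.not_odd_iff_even, ← Finset.odd_sum_iff_odd_card_odd, hs, hA, Nat.not_odd_iff_even]
    exact ⟨2 * m, by ring⟩
  have hOpos : 0 < #O := by
    obtain ⟨c, hc⟩ := hodd
    exact card_pos.2 ⟨c, by simpa [O] using hc⟩
  have hO3 : 3 * #O ≤ 4 * m := by
    rw [← hA, ← hs, mul_comm, ← smul_eq_mul, ← Finset.sum_const]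
    exact (sum_le_sum fun c hc => hthree c (by simpa [O] using hc)).trans
      (sum_le_univ_sum_of_nonneg fun _ => Nat.zero_le _)
  obtain ⟨i, hi⟩ := hOeven
  obtain ⟨j, hj⟩ := hm
  -- Of the odd classes, `p` receive triples `(T \ {0}) + h` with `h ∈ S ⊆ H`, and the others
  -- receive triples partitioning `S' ⊆ H`. Both `p` and `#O - p` are odd, so `S` and `S'` can be
  -- symmetric and contain 0; then the cores cover `T`. In the first case below, `#O ≥ 2` and `m`
  -- odd force `m ≥ 3`.
  obtain ⟨p, hp, hpO, hpm, hpo⟩ : ∃ p, Odd p ∧ p < #O ∧ p ≤ m ∧ 3 * (#O - p) ≤ m := by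
    rcases le_total (#O - 1) m with h | h
    · exact ⟨#O - 1, ⟨i - 1, by omega⟩, by omega, h, by omega⟩
    · exact ⟨m, ⟨j, hj⟩, by omega, le_rfl, by omega⟩
  obtain ⟨S, hSc, hS0, hSH, hSneg⟩ := exists_symmetric_subset H hH2 hp (hHc.symm ▸ hpm)
  obtain ⟨S', hS'c, hS'0, hS'H, hS'neg⟩ := exists_symmetric_subset H hH2
    (j := 3 * (#O - p)) (by obtain ⟨q, hq⟩ := hp; exact ⟨3 * (i - q) - 2, by omega⟩)
    (hHc.symm ▸ hpo)
  obtain ⟨O₁, hO₁, hO₁c⟩ := exists_subset_card_eq hpO.le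
  have hO₂c : #(O \ O₁) = #O - p := by rw [card_sdiff_of_subset hO₁, hO₁c]
  obtain ⟨R, hR, hRdis⟩ := exists_disjoint_family (P := fun _ : Finset A => True)
    (R := fun _ => True) (good := fun _ => True)
    (fun B j _ _ hj => by
      obtain ⟨Q, h1, h2⟩ := exists_subset_card_eq hj
      exact ⟨Q, h1, h2, trivial, trivial⟩)
    (fun _ => 3) (O \ O₁) S' trivial (fun _ _ => trivial)
    (by rw [sum_const, hO₂c, hS'c, smul_eq_mul, mul_comm])
  have hRS' : (O \ O₁).biUnion R = S' := by
    refine eq_of_subset_of_card_le (biUnion_subset.2 fun c hc => (hR c hc).1) ?_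
    rw [card_biUnion hRdis, sum_congr rfl fun c hc => (hR c hc).2.1, sum_const, hO₂c, hS'c,
      smul_eq_mul, mul_comm]
  have e : O₁ ≃ S := Finset.equivOfCardEq (hO₁c.trans hSc.symm)
  -- `g` indexes the translates by `S`; its value outside `O₁` plays no role.
  let g : K → A := fun c => if h : c ∈ O₁ then e ⟨c, h⟩ else 0
  have hgS : ∀ c ∈ O₁, g c ∈ S := fun c hc => by simp [g, hc]
  have hginj : ∀ c ∈ O₁, ∀ d ∈ O₁, g c = g d → c = d := fun c hc d hd h => by
    simpa [g, hc, hd] using h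
  have hgsurj : ∀ x ∈ S, ∃ c ∈ O₁, g c = x := fun x hx =>
    ⟨e.symm ⟨x, hx⟩, (e.symm ⟨x, hx⟩).2, by simp [g]⟩
  let R' : K → Finset A := fun c => if c ∈ O₁ then I (g c) else if c ∈ O then R c else ∅
  have hR'₁ : ∀ c ∈ O₁, R' c = I (g c) := fun c hc => by simp [R', hc]
  have hR'₂ : ∀ c ∈ O \ O₁, R' c = R c := fun c hc => by
    rw [mem_sdiff] at hc; simp [R', hc.1, hc.2]
  have hR'₃ : ∀ c, c ∉ O → R' c = ∅ := fun c hc => by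
    have : c ∉ O₁ := fun h => hc (hO₁ h)
    simp [R', hc, this]
  have hcases : ∀ c, c ∈ O₁ ∨ c ∈ O \ O₁ ∨ c ∉ O := fun c => by
    rw [mem_sdiff]; tauto
  have hR'c : ∀ c ∈ O, #(R' c) = 3 := by
    intro c hcO
    rcases hcases c with h | h | h
    · rw [hR'₁ c h, hIc]
    · rw [hR'₂ c h, (hR c h).2.1]
    · exact absurd hcO h
  have hIS' : ∀ c ∈ O₁, ∀ d ∈ O \ O₁, Disjoint (R' c) (R' d) := by
    intro c hc d hd
    rw [hR'₁ c hc, hR'₂ d hd, disjoint_left]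
    intro x hx hx'
    obtain ⟨t, ht, ht0, rfl⟩ := (hI _ _).1 hx
    refine ht0 (hdecomp t ht 0 (zero_mem _) (g c) (hSH _ (hgS c hc)) _
      (hS'H _ ((hR d hd).1 hx')) (zero_add _).symm).1
  have hmemI : ∀ t ∈ T, t ≠ 0 → ∀ x ∈ S, ∃ d, t + x ∈ R' d := by
    intro t ht ht0 x hx
    obtain ⟨d, hd, rfl⟩ := hgsurj x hx
    exact ⟨d, by rw [hR'₁ d hd, hI]; exact ⟨t, ht, ht0, rfl⟩⟩
  have hmemS' : ∀ x ∈ S', ∃ d, x ∈ R' d := by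
    intro x hx
    rw [← hRS', mem_biUnion] at hx
    obtain ⟨d, hd, hx⟩ := hx
    exact ⟨d, by rwa [hR'₂ d hd]⟩
  have hRdisj : Pairwise fun c d => Disjoint (R' c) (R' d) := by
    intro c' d hcd
    rcases hcases c' with h | h | h
    · rcases hcases d with h' | h' | h'
      · rw [hR'₁ c' h, hR'₁ d h', disjoint_left]
        intro x hx hx'
        obtain ⟨t, ht, -, rfl⟩ := (hI _ _).1 hx
        obtain ⟨t', ht', -, heq⟩ := (hI _ _).1 hx'
        exact hcd (hginj _ h _ h' (hdecomp t ht t' ht' _ (hSH _ (hgS _ h)) _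
          (hSH _ (hgS _ h')) heq).2)
      · exact hIS' _ h _ h'
      · rw [hR'₃ d h']; simp
    · rcases hcases d with h' | h' | h'
      · exact (hIS' _ h' _ h).symm
      · rw [hR'₂ c' h, hR'₂ d h']
        exact hRdis h h' hcd
      · rw [hR'₃ d h']; simp
    · rw [hR'₃ c' h]; simp
  have hRle : ∀ c, #(R' c) ≤ s c := by
    intro d
    by_cases hd : d ∈ O
    · rw [hR'c d hd]; exact hthree d (by simpa [O] using hd)
    · rw [hR'₃ d hd]; simp
  have hReven : ∀ c, Even (s c - #(R' c)) := by
    intro d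
    by_cases hd : d ∈ O
    · rw [hR'c d hd]
      have : Odd (s d) := by simpa [O] using hd
      exact Nat.Odd.sub_odd this (by decide)
    · rw [hR'₃ d hd]; simpa [O] using hd
  have hRneg : ∀ c, ∀ x ∈ R' c, ∃ d, -x ∈ R' d := by
    intro d x hx
    rcases hcases d with h | h | h
    · rw [hR'₁ d h] at hx
      obtain ⟨t, ht, ht0, rfl⟩ := (hI _ _).1 hx
      rw [neg_add]
      exact hmemI _ (neg_mem ht) (neg_ne_zero.2 ht0) _ (hSneg _ (hgS d h))
    · rw [hR'₂ d h] at hx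
      exact hmemS' _ (hS'neg _ ((hR d h).1 hx))
    · simp [hR'₃ d h] at hx
  have hRtwo : ∀ x : A, -x = x → ∃ d, x ∈ R' d := by
    intro x hx
    by_cases hx0 : x = 0
    · exact hmemS' x (hx0 ▸ hS'0)
    · simpa using hmemI x (htwo x hx) hx0 0 hS0
  obtain ⟨Q, h1, h2, h3⟩ := exists_extension s hs R' hRdisj hRle hReven hRneg hRtwo
  refine ⟨Q, h1, h2, fun d hd => ?_, fun d => ?_⟩
  · rw [h3, hR'₃ d (by simpa [O] using hd), sum_empty]
  · rw [h3]
    rcases hcases d with h | h | h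
    · rw [hR'₁ d h]; exact hIs _ (hSH _ (hgS d h))
    · rw [hR'₂ d h]
      exact Finset.even_sum _ fun x hx => hHeven x (hS'H x ((hR d h).1 hx))
    · rw [hR'₃ d h, sum_empty]; exact Even.zero

theorem single_sum {V A : Type*} [DecidableEq V] [AddCommGroup A] (r : V) (S : Finset V) (w : V → A) :
    (Pi.single r (∑ v ∈ S, w v) : V → A) = ∑ v ∈ S, Pi.single r (w v) :=
  map_sum (AddMonoidHom.single (fun _ : V => A) r) w S

/-! ### Which functions on the vertices are weighted degrees. -/

section Realization

variable {V : Type*} [Fintype V] [DecidableEq V] (G : SimpleGraph V) (A : Type*) [AddCommGroup A]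

/-- The functions on the vertices that are weighted degrees of an edge labeling. -/
def weightedDegrees : AddSubgroup (V → A) where
  carrier := {w | ∃ f : G.edgeSet → A, weightedDegree G f = w}
  zero_mem' := ⟨0, by ext v; simp [weightedDegree]⟩
  add_mem' := by
    rintro _ _ ⟨f, rfl⟩ ⟨g, rfl⟩
    exact ⟨f + g, by ext v; simp [weightedDegree, sum_add_distrib]⟩
  neg_mem' := by
    rintro _ ⟨f, rfl⟩
    exact ⟨-f, by ext v; simp [weightedDegree]⟩

variable {G A}

theorem single_add_single_mem {u v : V} (h : G.Adj u v) (x : A) :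
    (Pi.single u x + Pi.single v x : V → A) ∈ weightedDegrees G A := by
  classical
  refine ⟨Pi.single ⟨s(u, v), h⟩ x, ?_⟩
  ext z
  rw [weightedDegree, Finset.sum_filter, Finset.sum_eq_single (⟨s(u, v), h⟩ : G.edgeSet)]
  · have := h.ne
    by_cases h1 : z = u
    · subst h1; simp [this]
    · by_cases h2 : z = v
      · subst h2; simp [h1]
      · simp [h1, h2]
  · intro e _ he
    simp [he]
  · simp

/-- Labels `x, -x, x, ...` along the walk cancel at every intermediate step, leaving only the two
ends. -/
theorem single_sub_single_mem {u v : V} (p : G.Walk u v) (x : A) :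
    (Pi.single u x - Pi.single v ((-1 : ℤ) ^ p.length • x) : V → A) ∈ weightedDegrees G A := by
  induction p generalizing x with
  | nil => simp
  | @cons u v w h p ih =>
    have := sub_mem (single_add_single_mem h x) (ih x)
    convert this using 1
    rw [SimpleGraph.Walk.length_cons, pow_succ, mul_neg_one, neg_smul, Pi.single_neg]
    abel

theorem single_sub_single_mem_of_even {u v : V} (p : G.Walk u v) (hp : Even p.length) (x : A) :
    (Pi.single u x - Pi.single v x : V → A) ∈ weightedDegrees G A := by
  simpa [hp.neg_one_pow] using single_sub_single_mem p x

theorem single_add_single_mem_of_odd {u v : V} (p : G.Walk u v) (hp : Odd p.length) (x : A) :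
    (Pi.single u x + Pi.single v x : V → A) ∈ weightedDegrees G A := by
  simpa [hp.neg_one_pow, Pi.single_neg] using single_sub_single_mem p x

/-- If `r` has walks of both parities to some vertex, then the functions on the vertices reachable
from `r` whose sum is even are weighted degrees. -/
theorem sum_single_mem_of_even {r z : V} (p q : G.Walk r z) (hp : Even p.length)
    (hq : Odd q.length) (S : Finset V) (hS : ∀ v ∈ S, G.Reachable r v) (w : V → A)
    (hw : Even (∑ v ∈ S, w v)) :
    (∑ v ∈ S, Pi.single v (w v) : V → A) ∈ weightedDegrees G A := by
  -- The two walks form a closed walk of odd length at `r`, whose alternating labels add up at `r`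
  -- instead of cancelling. All values are then gathered at `r`, where their total has the form `y +
  -- y`.
  have hr : ∀ x : A, (Pi.single r x + Pi.single r x : V → A) ∈ weightedDegrees G A := by
    intro x
    have := add_mem (single_sub_single_mem_of_even p hp x) (single_add_single_mem_of_odd q hq x)
    convert this using 1
    abel
  have hsub : ∀ v ∈ S, (Pi.single v (w v) - Pi.single r (w v) : V → A) ∈ weightedDegrees G A := by
    intro v hv
    obtain ⟨t⟩ := hS v hv
    rcases Nat.even_or_odd t.length with h | h
    · have := neg_mem (single_sub_single_mem_of_even t h (w v))
      rwa [neg_sub] at this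
    · have := sub_mem (single_add_single_mem_of_odd t h (w v)) (hr (w v))
      convert this using 1
      abel
  have h1 := sum_mem hsub
  obtain ⟨y, hy⟩ := hw
  rw [sum_sub_distrib, ← single_sum, hy, Pi.single_add] at h1
  simpa using add_mem h1 (hr y)

/-- Functions on the vertices reachable from `r` with the same sum on the vertices at even and at
odd distance are weighted degrees. -/
theorem sum_single_mem_of_eq (r : V) (S T : Finset V)
    (hS : ∀ v ∈ S, ∃ p : G.Walk r v, Even p.length) (hT : ∀ v ∈ T, ∃ p : G.Walk r v, Odd p.length)
    (w : V → A) (hw : ∑ v ∈ S, w v = ∑ v ∈ T, w v) :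
    (∑ v ∈ S, Pi.single v (w v) + ∑ v ∈ T, Pi.single v (w v) : V → A) ∈ weightedDegrees G A := by
  -- Values from `S` and `T` reach `r` with opposite signs, so equal sums cancel there.
  have h1 : ∑ v ∈ S, (Pi.single r (w v) - Pi.single v (w v) : V → A) ∈ weightedDegrees G A :=
    sum_mem fun v hv => by
      obtain ⟨p, hp⟩ := hS v hv
      exact single_sub_single_mem_of_even p hp _
  have h2 : ∑ v ∈ T, (Pi.single r (w v) + Pi.single v (w v) : V → A) ∈ weightedDegrees G A :=
    sum_mem fun v hv => by
      obtain ⟨p, hp⟩ := hT v hv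
      exact single_add_single_mem_of_odd p hp _
  have h3 := sub_mem h2 h1
  rw [sum_sub_distrib, sum_add_distrib, ← single_sum, ← single_sum, hw] at h3
  convert h3 using 1
  abel

end Realization

/-! ### Color classes described by parities of walks. -/

section Main

variable {V : Type*} (G : SimpleGraph V)

/-- `v` is joined to the representative of its component by an even walk. -/
def EvenWalk (v : V) : Prop :=
  ∃ p : G.Walk (G.connectedComponentMk v).out v, Even p.length

/-- `v` is joined to the representative of its component by an odd walk. -/
def OddWalk (v : V) : Prop :=
  ∃ p : G.Walk (G.connectedComponentMk v).out v, Odd p.length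

/-- Some vertex of the component is joined to the representative by walks of both parities. -/
def Mixed (c : G.ConnectedComponent) : Prop :=
  ∃ v, G.connectedComponentMk v = c ∧ EvenWalk G v ∧ OddWalk G v

open Classical in
/-- The color class of a vertex: its component, with the parity of the walks from its representative
unless both occur. -/
noncomputable def colorKey (v : V) : G.ConnectedComponent × Bool :=
  (G.connectedComponentMk v, decide (¬ Mixed G (G.connectedComponentMk v) ∧ OddWalk G v))

variable {G}

theorem evenWalk_or_oddWalk (v : V) : EvenWalk G v ∨ OddWalk G v := by
  obtain ⟨p⟩ : G.Reachable (G.connectedComponentMk v).out v :=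
    SimpleGraph.ConnectedComponent.exact (Quot.out_eq _)
  exact (Nat.even_or_odd p.length).imp (fun h => ⟨p, h⟩) fun h => ⟨p, h⟩

theorem OddWalk.of_adj {u v : V} (h : G.Adj u v) (hu : EvenWalk G u) : OddWalk G v := by
  obtain ⟨p, hp⟩ := hu
  have he : G.connectedComponentMk u = G.connectedComponentMk v :=
    SimpleGraph.ConnectedComponent.sound h.reachable
  rw [OddWalk, ← he]
  exact ⟨p.concat h, by rw [SimpleGraph.Walk.length_concat]; exact hp.add_one⟩

theorem EvenWalk.of_adj {u v : V} (h : G.Adj u v) (hu : OddWalk G u) : EvenWalk G v := by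
  obtain ⟨p, hp⟩ := hu
  have he : G.connectedComponentMk u = G.connectedComponentMk v :=
    SimpleGraph.ConnectedComponent.sound h.reachable
  rw [EvenWalk, ← he]
  exact ⟨p.concat h, by rw [SimpleGraph.Walk.length_concat]; exact hp.add_one⟩

theorem not_oddWalk_iff {v : V} (h : ¬ Mixed G (G.connectedComponentMk v)) :
    ¬ OddWalk G v ↔ EvenWalk G v :=
  ⟨(evenWalk_or_oddWalk v).resolve_right, fun h1 h2 => h ⟨v, rfl, h1, h2⟩⟩

theorem oddWalk_iff_of_adj {u v : V} (h : G.Adj u v)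
    (hu : ¬ Mixed G (G.connectedComponentMk u)) : OddWalk G u ↔ ¬ OddWalk G v := by
  have he : G.connectedComponentMk u = G.connectedComponentMk v :=
    SimpleGraph.ConnectedComponent.sound h.reachable
  rw [not_oddWalk_iff (he ▸ hu)]
  exact ⟨fun h1 => .of_adj h h1, fun h1 => .of_adj h.symm h1⟩

theorem evenWalk_out (c : G.ConnectedComponent) : EvenWalk G c.out := by
  have h : G.connectedComponentMk c.out = c := Quot.out_eq c
  rw [EvenWalk, h]
  exact ⟨.nil, by simp⟩

/-- A component with at least two vertices has a vertex with an odd walk. -/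
theorem exists_oddWalk (c : G.ConnectedComponent) (hc : 2 ≤ c.supp.ncard) :
    ∃ v, G.connectedComponentMk v = c ∧ OddWalk G v := by
  obtain ⟨v, hv, hne⟩ := Set.exists_ne_of_one_lt_ncard hc c.out
  have h : G.connectedComponentMk c.out = c := Quot.out_eq c
  obtain ⟨p⟩ : G.Reachable c.out v :=
    SimpleGraph.ConnectedComponent.exact (h.trans (SimpleGraph.ConnectedComponent.mem_supp_iff _ _ |>.1 hv).symm)
  cases p with
  | nil => exact absurd rfl hne
  | @cons _ u _ hadj p =>
    exact ⟨u, (SimpleGraph.ConnectedComponent.sound hadj.reachable).symm.trans h,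
      .of_adj hadj (evenWalk_out c)⟩

variable [Fintype V]

-- In a component that is not mixed, parity of walks is a proper 2-coloring, so the hypothesis on
-- bipartite components makes both classes even. Both are nonempty, hence of size at least 2. A
-- mixed component uses only the key with `false`.
open Classical in
theorem card_colorKey (hcomp : ∀ c : G.ConnectedComponent, 3 ≤ c.supp.ncard)
    (hbip : BipartiteComponentsEven G) (c : G.ConnectedComponent) :
    (Mixed G c → 3 ≤ #{v | colorKey G v = (c, false)} ∧ #{v | colorKey G v = (c, true)} = 0) ∧
    (¬ Mixed G c → ∀ b, 2 ≤ #{v | colorKey G v = (c, b)} ∧ Even #{v | colorKey G v = (c, b)}) := by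
  refine ⟨fun h => ⟨?_, ?_⟩, fun h b => ?_⟩
  · refine (hcomp c).trans_eq ?_
    rw [Set.ncard_eq_toFinset_card']
    congr 1
    ext v
    simp only [Set.mem_toFinset, SimpleGraph.ConnectedComponent.mem_supp_iff, colorKey, mem_filter,
      mem_univ, true_and, Prod.mk.injEq, decide_eq_false_iff_not]
    constructor
    · rintro rfl; exact ⟨rfl, fun h' => h'.1 h⟩
    · exact fun h' => h'.1
  · rw [card_eq_zero, filter_eq_empty_iff]
    rintro v - hv
    simp only [colorKey, Prod.mk.injEq, decide_eq_true_eq] at hv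
    exact hv.2.1 (hv.1 ▸ h)
  · have heven : Even #{v | colorKey G v = (c, b)} := by
      let C : c.toSimpleGraph.Coloring Bool :=
        SimpleGraph.Coloring.mk (fun v => decide (OddWalk G v.1)) (by
          intro u v huv
          have hadj : G.Adj u.1 v.1 := huv
          have hu : G.connectedComponentMk u.1 = c := u.2
          have := oddWalk_iff_of_adj hadj (hu.symm ▸ h)
          by_cases h1 : OddWalk G u.1 <;> simp_all)
      convert hbip c C b
      rw [← Set.ncard_coe_finset, ← Set.ncard_image_of_injective _ Subtype.val_injective]
      congr 1
      ext v
      simp only [coe_filter, mem_univ, true_and, Set.mem_ofPred_eq, Set.mem_image, colorKey,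
        Prod.mk.injEq]
      constructor
      · rintro ⟨h1, h2⟩
        refine ⟨⟨v, h1⟩, ?_, rfl⟩
        change decide (OddWalk G v) = b
        simpa [h1, h] using h2
      · rintro ⟨⟨v, h1⟩, h2, rfl⟩
        have h1' : G.connectedComponentMk v = c := h1
        change decide (OddWalk G v) = b at h2
        refine ⟨h1, ?_⟩
        simpa [h1', h] using h2
    refine ⟨?_, heven⟩
    have hpos : 0 < #{v | colorKey G v = (c, b)} := by
      rw [card_pos]
      cases b
      · refine ⟨c.out, ?_⟩
        have hc : G.connectedComponentMk c.out = c := Quot.out_eq c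
        have := (not_oddWalk_iff (hc.symm ▸ h)).2 (evenWalk_out c)
        simp [colorKey, hc, this]
      · obtain ⟨v, hv, hodd⟩ := exists_oddWalk c (by have := hcomp c; omega)
        exact ⟨v, by simp [colorKey, hv, h, hodd]⟩
    obtain ⟨i, hi⟩ := heven
    omega

open Classical in
/-- A function with even sum on each mixed component and equal sums on both color classes of the
other components is a weighted degree. -/
theorem exists_weightedDegree_eq {A : Type*} [AddCommGroup A] (w : V → A)
    (hmixed : ∀ c, Mixed G c → Even (∑ v with colorKey G v = (c, false), w v))
    (hbip : ∀ c, ¬ Mixed G c → ∑ v with colorKey G v = (c, false), w v =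
      ∑ v with colorKey G v = (c, true), w v) :
    ∃ f : G.edgeSet → A, weightedDegree G f = w := by
  change w ∈ weightedDegrees G A
  have hw : w = ∑ c : G.ConnectedComponent, ∑ v with G.connectedComponentMk v = c,
      Pi.single v (w v) := by
    refine (Finset.univ_sum_single w).symm.trans ?_
    convert (Finset.sum_fiberwise univ G.connectedComponentMk _).symm
  rw [hw]
  refine sum_mem fun c _ => ?_
  have hout : G.connectedComponentMk c.out = c := Quot.out_eq c
  by_cases hc : Mixed G c
  · obtain ⟨z, hz, ⟨p, hp⟩, ⟨q, hq⟩⟩ := id hc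
    have hS : (univ.filter fun v => G.connectedComponentMk v = c) =
        univ.filter fun v => colorKey G v = (c, false) := by
      ext v
      simp only [mem_filter, mem_univ, true_and, colorKey, Prod.mk.injEq, decide_eq_false_iff_not]
      exact ⟨by rintro rfl; exact ⟨rfl, fun h => h.1 hc⟩, fun h => h.1⟩
    subst hz
    refine sum_single_mem_of_even p q hp hq _ (fun v hv => ?_) w ?_
    · exact SimpleGraph.ConnectedComponent.exact (hout.trans (by simpa using hv : _ = _).symm)
    · rw [hS]; exact hmixed _ hc
  · have hmem : ∀ v b, colorKey G v = (c, b) ↔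
        G.connectedComponentMk v = c ∧ (b = true ↔ OddWalk G v) := by
      intro v b
      simp only [colorKey, Prod.mk.injEq]
      refine and_congr_right fun h => ?_
      by_cases h1 : OddWalk G v <;> cases b <;> simp [h, hc, h1]
    have hS : (univ.filter fun v => G.connectedComponentMk v = c) =
        (univ.filter fun v => colorKey G v = (c, false)) ∪
          univ.filter fun v => colorKey G v = (c, true) := by
      ext v
      simp only [mem_union, mem_filter, mem_univ, true_and, hmem]
      by_cases h1 : OddWalk G v <;> simp [h1]
    rw [hS, sum_union]
    · refine sum_single_mem_of_eq c.out _ _ (fun v hv => ?_) (fun v hv => ?_) w (hbip c hc)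
      · simp only [mem_filter, mem_univ, true_and, hmem] at hv
        obtain ⟨rfl, h⟩ := hv
        exact (not_oddWalk_iff hc).1 (by simpa using h)
      · simp only [mem_filter, mem_univ, true_and, hmem] at hv
        obtain ⟨rfl, h⟩ := hv
        have h' : OddWalk G v := by simpa using h
        exact h'
    · rw [disjoint_filter]
      intro v _ h1 h2
      simpa using h1.symm.trans h2

/-! ### Assembling the irregular labeling. -/

/-- Disjoint sets of the sizes of the fibers of `κ` are the images of the fibers under an injective
map. -/
theorem exists_injective_of_card_fiber {A K : Type*} [DecidableEq K] [AddCommMonoid A]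
    (κ : V → K) (Q : K → Finset A) (hcard : ∀ c, #(Q c) = #{v | κ v = c})
    (hdis : Pairwise fun c d => Disjoint (Q c) (Q d)) :
    ∃ w : V → A, Function.Injective w ∧
      ∀ c, ∑ v with κ v = c, w v = ∑ x ∈ Q c, x := by
  classical
  have h : ∀ c, ∃ e : V → A, Set.BijOn e (univ.filter fun v => κ v = c : Finset V) (Q c) := by
    intro c
    refine (Finset.finite_toSet _).exists_bijOn_of_encard_eq ?_
    rw [Set.encard_coe_eq_coe_finsetCard, Set.encard_coe_eq_coe_finsetCard, hcard]
  choose e he using h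
  have hκ : ∀ v, v ∈ ((univ.filter fun u => κ u = κ v : Finset V) : Set V) := by simp
  refine ⟨fun v => e (κ v) v, fun u v huv => ?_, fun c => ?_⟩
  · have hu := (he (κ u)).mapsTo (hκ u)
    have hv := (he (κ v)).mapsTo (hκ v)
    have huv' : κ u = κ v := by
      by_contra hne
      refine disjoint_left.1 (hdis hne) hu ?_
      have : e (κ u) u = e (κ v) v := huv
      rw [this]; exact hv
    refine (he (κ u)).injOn (hκ u) (by simp [huv']) ?_
    have : e (κ u) u = e (κ v) v := huv
    rw [this, huv']
  · refine sum_bij (fun v _ => e c v) (fun v hv => (he c).mapsTo hv)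
      (fun u hu v hv h => (he c).injOn hu hv h) (fun x hx => ?_) (fun v hv => ?_)
    · obtain ⟨v, hv, rfl⟩ := (he c).surjOn hx
      exact ⟨v, hv, rfl⟩
    · simp only [(mem_filter.1 hv).2]

theorem exists_isIrregular (hn : Fintype.card V ≡ 4 [MOD 8])
    (hcomp : ∀ c : G.ConnectedComponent, 3 ≤ c.supp.ncard) (hbip : BipartiteComponentsEven G)
    {A : Type*} [AddCommGroup A] [Fintype A] (hA : Fintype.card A = Fintype.card V) :
    ∃ f : G.edgeSet → A, IsIrregular G f := by
  classical
  -- This is where the residue 4 modulo 8 enters: the 2-part of the order is exactly 4.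
  obtain ⟨m, hm, hAm⟩ : ∃ m, Odd m ∧ Fintype.card A = 4 * m := by
    have : Fintype.card V % 8 = 4 := hn
    exact ⟨2 * (Fintype.card V / 8) + 1, ⟨_, rfl⟩, by omega⟩
  let s : G.ConnectedComponent × Bool → ℕ := fun k => #{v | colorKey G v = k}
  have hs : ∑ k, s k = Fintype.card A := by
    rw [hA]
    exact (card_eq_sum_card_fiberwise (f := colorKey G) (t := univ) (by simp)).symm
  have hsize := card_colorKey hcomp hbip
  have hbipS : ∀ c, ¬ Mixed G c → ∀ b, 2 ≤ s (c, b) ∧ Even (s (c, b)) := fun c => (hsize c).2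
  have hmixT : ∀ c, Mixed G c → s (c, true) = 0 := fun c h => ((hsize c).1 h).2
  have hmixF : ∀ c, Mixed G c → 3 ≤ s (c, false) := fun c h => ((hsize c).1 h).1
  obtain ⟨Q, hQc, hQdis, hQmixed, hQbip⟩ : ∃ Q : G.ConnectedComponent × Bool → Finset A,
      (∀ k, #(Q k) = s k) ∧ (Pairwise fun k l => Disjoint (Q k) (Q l)) ∧
      (∀ c, Mixed G c → Even (∑ x ∈ Q (c, false), x)) ∧
      ∀ c, ¬ Mixed G c → ∑ x ∈ Q (c, false), x = ∑ x ∈ Q (c, true), x := by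
    by_cases hodd : ∃ k, Odd (s k)
    · obtain ⟨Q, h1, h2, h3, h4⟩ := exists_allocation_odd hm hAm s hs hodd (by
        rintro ⟨c, b⟩ hk
        by_cases hc : Mixed G c
        · cases b
          · exact hmixF c hc
          · rw [hmixT c hc] at hk; exact absurd hk (by decide)
        · exact absurd (hbipS c hc b).2 (Nat.not_even_iff_odd.2 hk))
      exact ⟨Q, h1, h2, fun c _ => h4 _, fun c hc => by
        rw [h3 _ (hbipS c hc _).2, h3 _ (hbipS c hc _).2]⟩
    · simp only [not_exists, Nat.not_odd_iff_even] at hodd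
      have : Nonempty V := by
        rw [← Fintype.card_pos_iff, ← hA]; exact Fintype.card_pos
      let c₀ := G.connectedComponentMk (Classical.arbitrary V)
      by_cases hc₀ : Mixed G c₀
      -- A mixed component must hold all of `T` by itself; its size is at least 3 and even.
      · have h4 : 4 ≤ s (c₀, false) := by
          obtain ⟨i, hi⟩ := hodd (c₀, false)
          have := hmixF c₀ hc₀
          omega
        obtain ⟨a, Q, h1, h2, h3⟩ := exists_allocation_even hm hAm s hs hodd (c₀, false) (c₀, false)
          (by omega) (by omega) (fun _ => h4)
        refine ⟨Q, h1, h2, fun c _ => ?_, fun c hc => ?_⟩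
        · rw [h3]; exact Even.add_self _
        · have : c ≠ c₀ := fun h => hc (h ▸ hc₀)
          simp [h3, this]
      · obtain ⟨a, Q, h1, h2, h3⟩ := exists_allocation_even hm hAm s hs hodd (c₀, false) (c₀, true)
          (hbipS _ hc₀ _).1 (hbipS _ hc₀ _).1 (by simp)
        refine ⟨Q, h1, h2, fun c hc => ?_, fun c _ => ?_⟩
        · have : c ≠ c₀ := fun h => hc₀ (h ▸ hc)
          simp [h3, this]
        · simp [h3]
  obtain ⟨w, hw, hsum⟩ := exists_injective_of_card_fiber (colorKey G) Q hQc hQdis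
  obtain ⟨f, hf⟩ := exists_weightedDegree_eq (G := G) w
    (fun c hc => by rw [hsum]; exact hQmixed c hc)
    (fun c hc => by rw [hsum, hsum]; exact hQbip c hc)
  exact ⟨f, by rw [IsIrregular, hf]; exact hw⟩

end Main

end GroupIrregularity

theorem mainTheorem5 {V : Type*} [Fintype V] (G : SimpleGraph V)
    (hn : Fintype.card V ≡ 4 [MOD 8])
    (hcomp : ∀ c : G.ConnectedComponent, 3 ≤ c.supp.ncard)
    (hbip : GroupIrregularity.BipartiteComponentsEven G) :
    GroupIrregularity.IsGroupIrregularityStrength G (Fintype.card V) := by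
  have hpos : 0 < Fintype.card V := by
    have : Fintype.card V % 8 = 4 := hn
    omega
  refine ⟨⟨hpos, fun A _ hA => ?_⟩, fun t ⟨ht, h⟩ => ?_⟩
  · have : Finite A := Nat.finite_of_card_ne_zero (by omega)
    have := Fintype.ofFinite A
    exact GroupIrregularity.exists_isIrregular hn hcomp hbip (by rw [← hA, Nat.card_eq_fintype_card])
  · obtain ⟨f, hf⟩ := h (ZMod t) (Nat.card_zmod t)
    have : NeZero t := ⟨ht.ne'⟩
    simpa [ZMod.card] using Fintype.card_le_of_injective _ hf
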